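/- Let $\mathbf k$ be an algebraically closed field of characteristic $0$, and put $\mathcal O=\mathbf k[[t]]$ and $F=\mathbf k((t))$. Let $\mathbf U$ be a unipotent linear algebraic group over $\mathbf k$, realized as a Zariski closed subgroup of some $\mathrm{GL}_p$, with Lie algebra $\mathfrak u\subseteq\mathfrak{gl}_p(\mathbf k)$, and put $\mathfrak u_F=\mathfrak u\otimes_{\mathbf k}F$. An element $x\in\mathbf U(F)$ acts on $\mathfrak u_F$ by the gauge action $x\cdot A=xAx^{-1}+\frac{dx}{dt}\,x^{-1}$. Let $n\ge 0$ be the nilpotency class of $\mathbf U$, normalized so that commutative groups have class $0$; that is, $n$ is the least integer $\geq 0$ such that the $(n+1)$-st term of the upper central series $1=Z_0\le Z_1=Z(\mathbf U)\le Z_2\le\cdots$ equals $\mathbf U$. Let $A=\sum_{j\ge m}A_jt^j\in\mathfrak u_F$ with $m\in\mathbb Z$, $A_j\in\mathfrak u$ and $A_m\ne 0$. (i) If $m>-1$, then there exists $x\in\mathbf U(\mathcal O)$ with $x\equiv 1 \pmod{t^{m+1}}$ and $x\cdot A=0$. (ii) If $m\le -1$, then the $\mathbf U(F)$-gauge equivalence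 class of $A$ is determined by the coefficients $A_j$ with $m\le j<n(|m|-1)$: every $B=\sum_j B_jt^j\in\mathfrak u_F$ with $B_j=A_j$ for all $j<n(|m|-1)$ (where $A_j=0$ for $j<m$) is of the form $x\cdot A$ with $x\in\mathbf U(F)$. More precisely, if $B\in\mathfrak u_F$ satisfies $B\equiv A\pmod{t^k}$ for some integer $k\ge n(|m|-1)$, then there exists $x\in\mathbf U(\mathcal O)$ with $x\equiv 1\pmod{t^{\,k-n|m|+n+1}}$ and $x\cdot A=B$. -/

import Mathlib

open scoped LaurentSeries PowerSeries

noncomputable section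

namespace FormalConnection

variable {k : Type*} [Field k] {p : ℕ}

/-- The value `f(M)` of a polynomial `f` in the `p²` matrix entries at a matrix `M` over a
`k`-algebra `R`. -/
def evalAt {R : Type*} [CommRing R] [Algebra k R] (M : Matrix (Fin p) (Fin p) R)
    (f : MvPolynomial (Fin p × Fin p) k) : R :=
  MvPolynomial.aeval (fun ij : Fin p × Fin p => M ij.1 ij.2) f

/-- A subgroup of `GL_p(k)` is Zariski closed if it is the zero locus in `GL_p(k)` of a set of
polynomials in the matrix entries. For `k` algebraically closed of characteristic zero (where
all group schemes of finite type are reduced), the Zariski closed subgroups of the groups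
`GL_p(k)` are exactly the (embedded) linear algebraic groups over `k`. -/
def IsZariskiClosed (U : Subgroup (GL (Fin p) k)) : Prop :=
  ∃ S : Set (MvPolynomial (Fin p × Fin p) k),
    ∀ g : GL (Fin p) k, g ∈ U ↔ ∀ f ∈ S, evalAt g.val f = 0

/-- The ideal of all polynomials in the matrix entries that vanish on `U`. -/
def vanishingIdeal (U : Subgroup (GL (Fin p) k)) : Ideal (MvPolynomial (Fin p × Fin p) k) where
  carrier := {f | ∀ g ∈ U, evalAt (g : GL (Fin p) k).val f = 0}
  zero_mem' := fun g _ => by simp [evalAt]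
  add_mem' := fun {a b} ha hb g hg => by
    have h1 := ha g hg
    have h2 := hb g hg
    simp only [evalAt] at h1 h2 ⊢
    rw [map_add, h1, h2, add_zero]
  smul_mem' := fun c f hf g hg => by
    have h1 := hf g hg
    simp only [evalAt] at h1 ⊢
    rw [smul_eq_mul, map_mul, h1, mul_zero]

/-- A linear algebraic group (Zariski closed subgroup of `GL_p(k)`) is unipotent if all its
elements are unipotent matrices, i.e. `g - 1` is nilpotent for every `g ∈ U`. -/
def IsUnipotentGroup (U : Subgroup (GL (Fin p) k)) : Prop :=
  IsZariskiClosed U ∧ ∀ g ∈ U, IsNilpotent ((g : GL (Fin p) k).val - 1)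

/-- The set `U(R)` of `R`-points of the algebraic group `U`, for a `k`-algebra `R`: the elements
of `GL_p(R)` at which all the polynomials vanishing on `U` vanish. -/
def points (U : Subgroup (GL (Fin p) k)) (R : Type*) [CommRing R] [Algebra k R] :
    Set (GL (Fin p) R) :=
  {g | ∀ f ∈ vanishingIdeal U, evalAt g.val f = 0}

/-- The Lie algebra `𝔲 = Lie(U) ⊆ 𝔤𝔩_p(k)`: the tangent space of `U` at the identity, i.e. the
matrices `X` with `∑ i j, (∂f/∂x_ij)(1) * X i j = 0` for every polynomial `f` vanishing on
`U`. -/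
def lieAlg (U : Subgroup (GL (Fin p) k)) : Submodule k (Matrix (Fin p) (Fin p) k) where
  carrier := {X | ∀ f ∈ vanishingIdeal U,
    ∑ i, ∑ j, evalAt (1 : Matrix (Fin p) (Fin p) k) (MvPolynomial.pderiv (i, j) f) * X i j = 0}
  zero_mem' := fun f _ => by simp
  add_mem' := fun {a b} ha hb f hf => by
    have h1 := ha f hf
    have h2 := hb f hf
    simp only [Matrix.add_apply, mul_add, Finset.sum_add_distrib]
    rw [h1, h2, add_zero]
  smul_mem' := fun c X hX f hf => by
    have h1 := hX f hf
    simp only [Matrix.smul_apply, smul_eq_mul, mul_left_comm _ c, ← Finset.mul_sum]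
    rw [h1, mul_zero]

/-- The `j`-th coefficient `A_j ∈ 𝔤𝔩_p(k)` of a matrix of Laurent series `A = ∑ A_j t^j`. -/
def coeffMat (A : Matrix (Fin p) (Fin p) k⸨X⸩) (j : ℤ) : Matrix (Fin p) (Fin p) k :=
  A.map fun f => f.coeff j

/-- `𝔲_F = 𝔲 ⊗_k k((t))`, as a subset of `𝔤𝔩_p(k((t)))`: since `𝔲` is finite dimensional, this
consists of the Laurent series `A = ∑ A_j t^j` all of whose coefficients lie in `𝔲`. Its elements
are the formal connections for the group `U` (on the trivial torsor over the punctured disc). -/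
def IsConnection (U : Subgroup (GL (Fin p) k)) (A : Matrix (Fin p) (Fin p) k⸨X⸩) : Prop :=
  ∀ j : ℤ, coeffMat A j ∈ lieAlg U

/-- `A = ∑_{j ≥ m} A_j t^j` with `A_m ≠ 0`. -/
def HasOrder (A : Matrix (Fin p) (Fin p) k⸨X⸩) (m : ℤ) : Prop :=
  (∀ j < m, coeffMat A j = 0) ∧ coeffMat A m ≠ 0

/-- Congruence `A ≡ B (mod t^e)` of matrices of Laurent series: equality of all the coefficients
in degrees `< e`. -/
def CongrMod (e : ℤ) (A B : Matrix (Fin p) (Fin p) k⸨X⸩) : Prop :=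
  ∀ j < e, coeffMat A j = coeffMat B j

/-- The natural map `GL_p(k[[t]]) → GL_p(k((t)))`. -/
def toLaurent (x : GL (Fin p) k⟦X⟧) : GL (Fin p) k⸨X⸩ :=
  Matrix.GeneralLinearGroup.map (HahnSeries.ofPowerSeries ℤ k) x

/-- The gauge action `x · A = Ad(x) A + dx x⁻¹ = x A x⁻¹ + (dx/dt) x⁻¹`. -/
def gauge (x : GL (Fin p) k⸨X⸩) (A : Matrix (Fin p) (Fin p) k⸨X⸩) :
    Matrix (Fin p) (Fin p) k⸨X⸩ :=
  x.val * A * (x⁻¹).val + x.val.map (LaurentSeries.derivative k) * (x⁻¹).val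

/-- The group `G` has nilpotency class `n`, in the normalization in which commutative groups have
class `0` and `G` has class one more than `G / Z(G)` for noncommutative `G`: `n` is the least
number such that the `(n+1)`-st term of the upper central series
`1 = Z_0 ≤ Z_1 = Z(G) ≤ Z_2 ≤ ⋯` is the whole of `G`. -/
def HasNilClass (G : Type*) [Group G] (n : ℕ) : Prop :=
  IsLeast {i : ℕ | Subgroup.upperCentralSeries G (i + 1) = ⊤} n

end FormalConnection

end

/-! Put `r = |m|` (or `r = 1` when `A` is regular) and solve `dy/dt = (B - A) y`, `y(0) = 1`.
Gauging `A` by `y` gives `C = B + D` with `D = y A y⁻¹ - A`, so the error `B - A` is replaced by `B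
- C = -D`. If `B - A` has order at least `e ≥ 0`, then `y ≡ 1` modulo `t^(e+1)` and `D` has order at
least `e + 1 - r`: a step costs `r - 1` in order. In exchange, if `B - A` lies in the `(i+1)`-st
term of the upper central series of `𝔲`, tensored with `F`, then `D` lies in the `i`-th term. After
`n + 1` steps the error is zero. The cost of the last step is immaterial, hence the bound `n(r -
1)`.

Three facts carry this. The solution `y` is a point of `U` (`mem_points_of_deriv`), because `f(y)`
for `f` in the vanishing ideal satisfies a linear system with zero initial value. The class of the
group bounds that of `𝔲` (`lieAlg_le_centralSeries`), by differentiating commutators over the dual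
numbers. And `Ad(y) - 1` lowers the central series (`conj_sub_mem_extendScalars`): `N = Ad(y)X`
solves `dN/dt = [E, N]` with `N(0) = X`, where `E` is the logarithmic derivative of `y`, and
integration in characteristic zero preserves subspaces. No exponential map is needed. -/

noncomputable section

namespace FormalConnection

open Matrix

variable {k : Type*} [Field k] {p : ℕ}

/-! ### Polynomial matrices and the transfer principle -/

section Evaluation

variable {R : Type*} [CommRing R] [Algebra k R]

/-- Evaluation of a matrix of polynomials in the matrix entries at the matrix `M`. -/
def evalMat (M : Matrix (Fin p) (Fin p) R) :
    Matrix (Fin p) (Fin p) (MvPolynomial (Fin p × Fin p) k) →ₐ[k] Matrix (Fin p) (Fin p) R :=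
  (MvPolynomial.aeval (fun ij : Fin p × Fin p => M ij.1 ij.2)).mapMatrix

theorem evalMat_apply (M : Matrix (Fin p) (Fin p) R)
    (Q : Matrix (Fin p) (Fin p) (MvPolynomial (Fin p × Fin p) k)) (i j : Fin p) :
    evalMat M Q i j = evalAt M (Q i j) := rfl

/-- A constant matrix over a `k`-algebra. -/
def constMat (R : Type*) [CommRing R] [Algebra k R] :
    Matrix (Fin p) (Fin p) k →ₐ[k] Matrix (Fin p) (Fin p) R :=
  (Algebra.ofId k R).mapMatrix

theorem constMat_apply (X : Matrix (Fin p) (Fin p) k) (i j : Fin p) :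
    constMat R X i j = algebraMap k R (X i j) := rfl

theorem constMat_self (X : Matrix (Fin p) (Fin p) k) : constMat k X = X := rfl

@[simp]
theorem evalMat_constMat (M : Matrix (Fin p) (Fin p) R) (X : Matrix (Fin p) (Fin p) k) :
    evalMat M (constMat (MvPolynomial (Fin p × Fin p) k) X) = constMat R X := by
  ext i j
  simp [evalMat, constMat, Algebra.ofId_apply]

@[simp]
theorem evalMat_generic (M : Matrix (Fin p) (Fin p) R) :
    evalMat M (mvPolynomialX (Fin p) (Fin p) k) = M := by
  ext i j
  simp [evalMat]

theorem evalMat_adjugate (M : Matrix (Fin p) (Fin p) R)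
    (Q : Matrix (Fin p) (Fin p) (MvPolynomial (Fin p × Fin p) k)) :
    evalMat M Q.adjugate = (evalMat M Q).adjugate :=
  AlgHom.map_adjugate _ _

theorem evalAt_add (M : Matrix (Fin p) (Fin p) R) (f g : MvPolynomial (Fin p × Fin p) k) :
    evalAt M (f + g) = evalAt M f + evalAt M g := map_add _ _ _

theorem evalAt_mul (M : Matrix (Fin p) (Fin p) R) (f g : MvPolynomial (Fin p × Fin p) k) :
    evalAt M (f * g) = evalAt M f * evalAt M g := map_mul _ _ _

theorem evalAt_sub (M : Matrix (Fin p) (Fin p) R) (f g : MvPolynomial (Fin p × Fin p) k) :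
    evalAt M (f - g) = evalAt M f - evalAt M g := map_sub _ _ _

theorem evalAt_one (M : Matrix (Fin p) (Fin p) R) :
    evalAt M (1 : MvPolynomial (Fin p × Fin p) k) = 1 := map_one _

theorem evalAt_det (M : Matrix (Fin p) (Fin p) R)
    (Q : Matrix (Fin p) (Fin p) (MvPolynomial (Fin p × Fin p) k)) :
    evalAt M Q.det = (evalMat M Q).det := AlgHom.map_det _ _

theorem evalAt_sum {ι : Type*} (s : Finset ι) (M : Matrix (Fin p) (Fin p) R)
    (f : ι → MvPolynomial (Fin p × Fin p) k) :
    evalAt M (∑ a ∈ s, f a) = ∑ a ∈ s, evalAt M (f a) := map_sum _ _ _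

theorem evalAt_C (M : Matrix (Fin p) (Fin p) R) (c : k) :
    evalAt M (MvPolynomial.C c) = algebraMap k R c := MvPolynomial.aeval_C _ _

theorem evalAt_X (M : Matrix (Fin p) (Fin p) R) (a : Fin p × Fin p) :
    evalAt M (MvPolynomial.X a : MvPolynomial _ k) = M a.1 a.2 := MvPolynomial.aeval_X _ _

/-- Substitution of a matrix of polynomials for the generic matrix. -/
def substMat (Q : Matrix (Fin p) (Fin p) (MvPolynomial (Fin p × Fin p) k))
    (f : MvPolynomial (Fin p × Fin p) k) : MvPolynomial (Fin p × Fin p) k :=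
  evalAt Q f

theorem evalAt_substMat (M : Matrix (Fin p) (Fin p) R)
    (Q : Matrix (Fin p) (Fin p) (MvPolynomial (Fin p × Fin p) k))
    (f : MvPolynomial (Fin p × Fin p) k) :
    evalAt M (substMat Q f) = evalAt (evalMat M Q) f := by
  have := MvPolynomial.comp_aeval_apply (fun ij : Fin p × Fin p => Q ij.1 ij.2)
    (MvPolynomial.aeval (R := k) (fun ij : Fin p × Fin p => M ij.1 ij.2)) f
  exact this

theorem evalAt_map {S : Type*} [CommRing S] [Algebra k S] (e : R →ₐ[k] S)
    (M : Matrix (Fin p) (Fin p) R) (f : MvPolynomial (Fin p × Fin p) k) :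
    evalAt (M.map e) f = e (evalAt M f) :=
  (MvPolynomial.comp_aeval_apply (fun ij : Fin p × Fin p => M ij.1 ij.2) e f).symm

/-- The chain rule for polynomials in the matrix entries, for a derivation along an algebra
homomorphism. -/
theorem derivation_evalAt {S : Type*} [CommRing S] [Algebra k S] (e : R →ₐ[k] S) (d : R →ₗ[k] S)
    (hd : ∀ a b, d (a * b) = d a * e b + e a * d b)
    (M : Matrix (Fin p) (Fin p) R) (f : MvPolynomial (Fin p × Fin p) k) :
    d (evalAt M f) =
      ∑ i, ∑ j, evalAt (M.map e) (MvPolynomial.pderiv (i, j) f) * d (M i j) := by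
  have h1 : d 1 = 0 := by simpa using hd 1 1
  induction f using MvPolynomial.induction_on with
  | C c =>
    rw [evalAt_C, Algebra.algebraMap_eq_smul_one, map_smul, h1]
    simp [evalAt]
  | add f g hf hg =>
    simp only [evalAt_add, map_add, hf, hg, add_mul, Finset.sum_add_distrib]
  | mul_X f a hf =>
    rw [evalAt_mul, evalAt_X, hd, hf]
    simp only [Derivation.leibniz, smul_eq_mul, evalAt_add, evalAt_mul, evalAt_X, add_mul,
      Finset.sum_add_distrib, MvPolynomial.pderiv_X]
    rw [add_comm, Finset.sum_mul]
    congr 1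
    · rw [Finset.sum_eq_single a.1, Finset.sum_eq_single a.2]
      · rw [evalAt_map e M f]
        simp [evalAt]
      · intro j _ hj
        rw [Pi.single_eq_of_ne (fun h => hj (by rw [h]))]
        simp [evalAt]
      · simp
      · intro i _ hi
        refine Finset.sum_eq_zero fun j _ => ?_
        rw [Pi.single_eq_of_ne (fun h => hi (by rw [h]))]
        simp [evalAt]
      · simp
    · refine Finset.sum_congr rfl fun i _ => ?_
      rw [Finset.sum_mul]
      exact Finset.sum_congr rfl fun j _ => by rw [map_apply]; ring

end Evaluation

theorem linearMap_apply_eq_sum (φ : Matrix (Fin p) (Fin p) k →ₗ[k] k)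
    (X : Matrix (Fin p) (Fin p) k) :
    φ X = ∑ i, ∑ j, φ (single i j 1) * X i j := by
  conv_lhs => rw [matrix_eq_sum_single X]
  simp only [map_sum]
  refine Finset.sum_congr rfl fun i _ => Finset.sum_congr rfl fun j _ => ?_
  rw [show single i j (X i j) = X i j • single i j (1 : k) by simp [smul_single], map_smul,
    smul_eq_mul, mul_comm]

/-- If a matrix of polynomials takes values in a subspace `V` on `U`, then the components of its
values at points of `U` over any `k`-algebra lie in `V`. -/
theorem map_evalMat_mem {U : Subgroup (GL (Fin p) k)}
    {V : Submodule k (Matrix (Fin p) (Fin p) k)}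
    {Q : Matrix (Fin p) (Fin p) (MvPolynomial (Fin p × Fin p) k)}
    (hQ : ∀ g ∈ U, evalMat (g : GL (Fin p) k).val Q ∈ V)
    {R : Type*} [CommRing R] [Algebra k R] {M : Matrix (Fin p) (Fin p) R}
    (hM : ∀ f ∈ vanishingIdeal U, evalAt M f = 0) (l : R →ₗ[k] k) :
    (evalMat M Q).map l ∈ V := by
  by_contra hV
  -- A functional `φ` killing `V` but not this component turns `Q` into a scalar polynomial `φ(Q)`
  -- in the vanishing ideal, which must then vanish at `M`.
  obtain ⟨φ, hφ, hker⟩ := Submodule.exists_le_ker_of_notMem hV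
  apply hφ
  have hmem : (∑ i, ∑ j, MvPolynomial.C (φ (single i j 1)) * Q i j) ∈ vanishingIdeal U := by
    intro g hg
    have : evalAt g.val (∑ i, ∑ j, MvPolynomial.C (φ (single i j 1)) * Q i j) =
        ∑ i, ∑ j, φ (single i j 1) • evalMat g.val Q i j := by
      simp only [evalAt_sum, evalAt_mul, evalAt_C, evalMat_apply, Algebra.smul_def]
    rw [this]
    simp only [smul_eq_mul]
    rw [← linearMap_apply_eq_sum]
    exact hker (hQ g hg)
  have h0 := hM _ hmem
  simp only [evalAt_sum, evalAt_mul, evalAt_C, ← Algebra.smul_def] at h0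
  have h1 := congrArg l h0
  rw [linearMap_apply_eq_sum]
  simpa only [map_sum, map_smul, smul_eq_mul, map_zero, map_apply, evalMat_apply] using h1

/-! ### First order deformations -/

/-- The matrix `g + ε Y` over the dual numbers. -/
def dualMat (g Y : Matrix (Fin p) (Fin p) k) : Matrix (Fin p) (Fin p) (DualNumber k) :=
  fun i j => TrivSqZeroExt.inl (g i j) + TrivSqZeroExt.inr (Y i j)

theorem dualMat_mul (g Y h Z : Matrix (Fin p) (Fin p) k) :
    dualMat g Y * dualMat h Z = dualMat (g * h) (g * Z + Y * h) := by
  ext i j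
  · simp [dualMat, mul_apply, TrivSqZeroExt.fst_sum]
  · simp [dualMat, mul_apply, TrivSqZeroExt.snd_sum, Finset.sum_add_distrib, mul_comm]

theorem dualMat_sub (g Y h Z : Matrix (Fin p) (Fin p) k) :
    dualMat g Y - dualMat h Z = dualMat (g - h) (Y - Z) := by
  ext i j <;> simp [dualMat]

theorem dualMat_one : dualMat (1 : Matrix (Fin p) (Fin p) k) 0 = 1 := by
  ext i j
  · by_cases h : i = j <;> simp [dualMat, one_apply, h]
  · by_cases h : i = j <;> simp [dualMat, one_apply, h]

theorem constMat_dualNumber (X : Matrix (Fin p) (Fin p) k) :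
    constMat (DualNumber k) X = dualMat X 0 := by
  ext i j <;> simp [dualMat, constMat_apply, TrivSqZeroExt.algebraMap_eq_inl]

theorem evalAt_dualMat (g Y : Matrix (Fin p) (Fin p) k) (f : MvPolynomial (Fin p × Fin p) k) :
    evalAt (dualMat g Y) f = TrivSqZeroExt.inl (evalAt g f) +
      TrivSqZeroExt.inr (∑ i, ∑ j, evalAt g (MvPolynomial.pderiv (i, j) f) * Y i j) := by
  have hg : (dualMat g Y).map (TrivSqZeroExt.fstHom k k k) = g := by
    ext i j
    simp [dualMat]
  ext
  · have := evalAt_map (TrivSqZeroExt.fstHom k k k) (dualMat g Y) f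
    rw [hg] at this
    simpa using this.symm
  · have := derivation_evalAt (TrivSqZeroExt.fstHom k k k) (TrivSqZeroExt.sndHom k k)
      (fun a b => by simp [mul_comm, add_comm]) (dualMat g Y) f
    rw [hg] at this
    simpa [dualMat] using this

/-- Tangent vectors are the dual-number points `1 + εX` of `U`, so polynomial identities on `U` can
be differentiated by evaluating them there. -/
theorem mem_lieAlg_iff {U : Subgroup (GL (Fin p) k)} {X : Matrix (Fin p) (Fin p) k} :
    X ∈ lieAlg U ↔ ∀ f ∈ vanishingIdeal U, evalAt (dualMat 1 X) f = 0 := by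
  refine forall₂_congr fun f hf => ?_
  have h1 : evalAt (1 : Matrix (Fin p) (Fin p) k) f = 0 := hf 1 U.one_mem
  rw [evalAt_dualMat, h1, TrivSqZeroExt.inl_zero, zero_add, ← TrivSqZeroExt.inr_zero k,
    TrivSqZeroExt.inr_injective.eq_iff]

/-- Differentiating at `1` in the direction of `X ∈ Lie(U)` a matrix of polynomials that takes
values in a subspace `V` on `U` gives an element of `V`. -/
theorem snd_evalMat_dualMat_mem {U : Subgroup (GL (Fin p) k)}
    {V : Submodule k (Matrix (Fin p) (Fin p) k)}
    {Q : Matrix (Fin p) (Fin p) (MvPolynomial (Fin p × Fin p) k)}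
    (hQ : ∀ g ∈ U, evalMat (g : GL (Fin p) k).val Q ∈ V)
    {X A B : Matrix (Fin p) (Fin p) k} (hX : X ∈ lieAlg U)
    (h : evalMat (dualMat 1 X) Q = dualMat A B) : B ∈ V := by
  have := map_evalMat_mem hQ (mem_lieAlg_iff.1 hX) (TrivSqZeroExt.sndHom k k)
  rw [h] at this
  convert this using 1
  ext i j
  simp [dualMat]

/-- The vector field `g ↦ Xg` is tangent to `U`: differentiate the right translate `h ↦ f(hg)` at `h
= 1`. -/
theorem pderiv_mem_vanishingIdeal {U : Subgroup (GL (Fin p) k)} {X : Matrix (Fin p) (Fin p) k}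
    (hX : X ∈ lieAlg U) {f : MvPolynomial (Fin p × Fin p) k} (hf : f ∈ vanishingIdeal U) :
    ∑ i, ∑ j, MvPolynomial.pderiv (i, j) f *
      (constMat (MvPolynomial (Fin p × Fin p) k) X * mvPolynomialX (Fin p) (Fin p) k) i j ∈
        vanishingIdeal U := by
  intro g hg
  have hmem : substMat (mvPolynomialX (Fin p) (Fin p) k * constMat _ g.val) f ∈
      vanishingIdeal U := by
    intro h hh
    rw [evalAt_substMat]
    simpa [constMat_self] using hf (h * g) (U.mul_mem hh hg)
  have h2 := mem_lieAlg_iff.1 hX _ hmem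
  rw [evalAt_substMat, map_mul, evalMat_generic, evalMat_constMat, constMat_dualNumber,
    dualMat_mul, evalAt_dualMat] at h2
  have h3 := congrArg TrivSqZeroExt.snd h2
  simp only [one_mul, mul_zero, zero_add, TrivSqZeroExt.snd_add, TrivSqZeroExt.snd_inl,
    TrivSqZeroExt.snd_inr, TrivSqZeroExt.snd_zero] at h3
  simp only [evalAt_sum, evalAt_mul, ← evalMat_apply, map_mul, evalMat_generic, evalMat_constMat,
    constMat_self]
  exact h3

/-! ### Unipotent groups -/

/-- The characteristic polynomial of `-N` is `X^p`; evaluate it at `1`. -/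
theorem det_one_add_of_isNilpotent {N : Matrix (Fin p) (Fin p) k} (hN : IsNilpotent N) :
    (1 + N).det = 1 := by
  have h := (isNilpotent_charpoly_sub_pow_of_isNilpotent hN.neg).eq_zero
  rw [sub_eq_zero] at h
  have h2 := congrArg (Polynomial.eval 1) h
  rw [eval_charpoly] at h2
  simpa using h2

theorem IsUnipotentGroup.det_eq_one {U : Subgroup (GL (Fin p) k)} (hU : IsUnipotentGroup U)
    {g : GL (Fin p) k} (hg : g ∈ U) : g.val.det = 1 := by
  have := det_one_add_of_isNilpotent (hU.2 g hg)
  rwa [add_sub_cancel] at this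

/-- This makes inversion polynomial in the entries, so that conjugations and commutators are
accessible to `evalMat`. -/
theorem IsUnipotentGroup.adjugate_eq {U : Subgroup (GL (Fin p) k)} (hU : IsUnipotentGroup U)
    {g : GL (Fin p) k} (hg : g ∈ U) : g.val.adjugate = (g⁻¹).val := by
  have h := adjugate_mul g.val
  rw [hU.det_eq_one hg, one_smul] at h
  calc g.val.adjugate = g.val.adjugate * (g.val * (g⁻¹).val) := by
        rw [← Units.val_mul, mul_inv_cancel, Units.val_one, mul_one]
    _ = _ := by rw [← mul_assoc, h, one_mul]

theorem IsUnipotentGroup.det_eq_one_of_points {U : Subgroup (GL (Fin p) k)}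
    (hU : IsUnipotentGroup U) {R : Type*} [CommRing R] [Algebra k R]
    {M : Matrix (Fin p) (Fin p) R} (hM : ∀ f ∈ vanishingIdeal U, evalAt M f = 0) :
    M.det = 1 := by
  have hmem : (mvPolynomialX (Fin p) (Fin p) k).det - 1 ∈ vanishingIdeal U := by
    intro g hg
    rw [evalAt_sub, evalAt_one, evalAt_det, evalMat_generic, hU.det_eq_one hg, sub_self]
  have := hM _ hmem
  rwa [evalAt_sub, evalAt_one, evalAt_det, evalMat_generic, sub_eq_zero] at this

theorem adjugate_eq_of_mul_eq_one {R : Type*} [CommRing R] {M N : Matrix (Fin p) (Fin p) R}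
    (hM : M.det = 1) (h : M * N = 1) : M.adjugate = N := by
  have h1 := adjugate_mul M
  rw [hM, one_smul] at h1
  calc M.adjugate = M.adjugate * (M * N) := by rw [h, mul_one]
    _ = N := by rw [← mul_assoc, h1, one_mul]

theorem IsUnipotentGroup.adjugate_dualMat {U : Subgroup (GL (Fin p) k)} (hU : IsUnipotentGroup U)
    {X : Matrix (Fin p) (Fin p) k} (hX : X ∈ lieAlg U) :
    (dualMat 1 X).adjugate = dualMat 1 (-X) := by
  refine adjugate_eq_of_mul_eq_one (hU.det_eq_one_of_points (mem_lieAlg_iff.1 hX)) ?_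
  rw [dualMat_mul, ← dualMat_one]
  simp

/-- The adjoint action of `U` preserves its Lie algebra. -/
theorem conj_mem_lieAlg {U : Subgroup (GL (Fin p) k)} {g : GL (Fin p) k} (hg : g ∈ U)
    {X : Matrix (Fin p) (Fin p) k} (hX : X ∈ lieAlg U) :
    g.val * X * (g⁻¹).val ∈ lieAlg U := by
  rw [mem_lieAlg_iff]
  intro f hf
  have hmem : substMat (constMat _ g.val * mvPolynomialX (Fin p) (Fin p) k *
      constMat _ (g⁻¹).val) f ∈ vanishingIdeal U := by
    intro h hh
    rw [evalAt_substMat]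
    simpa [constMat_self] using hf (g * h * g⁻¹) (U.mul_mem (U.mul_mem hg hh) (U.inv_mem hg))
  have h2 := mem_lieAlg_iff.1 hX _ hmem
  rw [evalAt_substMat, map_mul, map_mul, evalMat_generic, evalMat_constMat, evalMat_constMat,
    constMat_dualNumber, constMat_dualNumber, dualMat_mul, dualMat_mul] at h2
  simpa using h2

/-- The upper central series of `𝔲`, computed inside `𝔤𝔩_p`. -/
def centralSeries (U : Subgroup (GL (Fin p) k)) : ℕ → Submodule k (Matrix (Fin p) (Fin p) k)
  | 0 => ⊥
  | i + 1 =>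
    { carrier := {W | ∀ Y ∈ lieAlg U, W * Y - Y * W ∈ centralSeries U i}
      zero_mem' := fun Y _ => by simp
      add_mem' := fun {a b} ha hb Y hY => by
        have := Submodule.add_mem _ (ha Y hY) (hb Y hY)
        rwa [show a * Y - Y * a + (b * Y - Y * b) = (a + b) * Y - Y * (a + b) by noncomm_ring]
          at this
      smul_mem' := fun c W hW Y hY => by
        have := Submodule.smul_mem _ c (hW Y hY)
        rwa [smul_sub, ← smul_mul_assoc, ← mul_smul_comm] at this }

theorem mem_centralSeries_succ {U : Subgroup (GL (Fin p) k)} {i : ℕ}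
    {W : Matrix (Fin p) (Fin p) k} :
    W ∈ centralSeries U (i + 1) ↔ ∀ Y ∈ lieAlg U, W * Y - Y * W ∈ centralSeries U i := Iff.rfl

/-- By induction on `i`: for `g ∈ U` the commutator `[m, g]` lies one term lower, so `Ad([m, g])Z -
Z` lies in term `i`. At `g = 1 + εY` one has `[m, g] = 1 + εW` with `W = Ad(m)Y - Y`, and the
derivative is `[W, Z]`. -/
theorem conj_sub_mem_centralSeries {U : Subgroup (GL (Fin p) k)} (hU : IsUnipotentGroup U)
    (i : ℕ) (m : U) (hm : m ∈ Subgroup.upperCentralSeries U (i + 1))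
    {Y : Matrix (Fin p) (Fin p) k} (hY : Y ∈ lieAlg U) :
    m.val.val * Y * (m⁻¹).val.val - Y ∈ centralSeries U i := by
  induction i generalizing m Y with
  | zero =>
    have hinv : m.val.val * (m⁻¹).val.val = 1 := by
      rw [← Units.val_mul, ← Subgroup.coe_mul, mul_inv_cancel]; rfl
    set M := m.val.val with hMdef
    set M' := (m⁻¹).val.val with hM'def
    have hcomm : ∀ g ∈ U, evalMat (g : GL (Fin p) k).val
        (constMat _ M * mvPolynomialX (Fin p) (Fin p) k -
          mvPolynomialX (Fin p) (Fin p) k * constMat _ M) ∈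
        (⊥ : Submodule k (Matrix (Fin p) (Fin p) k)) := by
      intro g hg
      rw [zero_add, Subgroup.upperCentralSeries_one, Subgroup.mem_center_iff] at hm
      have h1 := congrArg (fun u : U => u.val.val) (hm ⟨g, hg⟩)
      simp only [Subgroup.coe_mul, Units.val_mul] at h1
      simp [constMat_self, hMdef, h1]
    have h2 := snd_evalMat_dualMat_mem hcomm hY (A := 0) (B := M * Y - Y * M) (by
      rw [map_sub, map_mul, map_mul, evalMat_generic, evalMat_constMat, constMat_dualNumber,
        dualMat_mul, dualMat_mul, dualMat_sub]
      simp)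
    rw [Submodule.mem_bot, sub_eq_zero] at h2
    change _ ∈ (⊥ : Submodule k (Matrix (Fin p) (Fin p) k))
    rw [h2, mul_assoc, hinv, mul_one, sub_self]
    exact Submodule.zero_mem _
  | succ i ih =>
    intro Z hZ
    have hinv : m.val.val * (m⁻¹).val.val = 1 := by
      rw [← Units.val_mul, ← Subgroup.coe_mul, mul_inv_cancel]; rfl
    set M := m.val.val with hMdef
    set M' := (m⁻¹).val.val with hM'def
    set G := mvPolynomialX (Fin p) (Fin p) k
    have hcomm : ∀ g ∈ U, evalMat (g : GL (Fin p) k).val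
        (constMat _ M * G * constMat _ M' * G.adjugate * constMat _ Z *
          (G * constMat _ M * G.adjugate * constMat _ M') - constMat _ Z) ∈
        centralSeries U i := by
      intro g hg
      rw [Subgroup.mem_upperCentralSeries_succ_iff] at hm
      have h1 := ih _ (hm ⟨g, hg⟩) hZ
      simp only [map_sub, map_mul, evalMat_adjugate, evalMat_constMat, G, evalMat_generic,
        constMat_self, hU.adjugate_eq hg]
      simpa [commutatorElement_def, mul_assoc, hMdef, hM'def] using h1
    set W := M * Y * M' - Y with hW
    refine snd_evalMat_dualMat_mem hcomm hY (A := 0) ?_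
    simp only [map_sub, map_mul, evalMat_adjugate, evalMat_constMat, G, evalMat_generic,
      constMat_dualNumber, hU.adjugate_dualMat hY]
    simp only [dualMat_mul, dualMat_sub]
    congr 1
    · simp [hinv]
    · have h1 : (-(M * Y) + Y * M) * M' = -W := by
        rw [add_mul, mul_assoc Y, hinv, mul_one, neg_mul, hW]
        abel
      have h2 : -Y + M * Y * M' = W := by rw [hW]; abel
      simp [hinv, h1, h2]
      abel

/-- If `U` is nilpotent of class `n` then so is its Lie algebra. -/
theorem lieAlg_le_centralSeries {U : Subgroup (GL (Fin p) k)} (hU : IsUnipotentGroup U) {n : ℕ}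
    (hn : Subgroup.upperCentralSeries U (n + 1) = ⊤) : lieAlg U ≤ centralSeries U (n + 1) := by
  intro X hX Y hY
  set G := mvPolynomialX (Fin p) (Fin p) k
  -- The derivative of `Ad(g)Y - Y` at `g = 1` in the direction `X` is `[X, Y]`.
  have hcomm : ∀ g ∈ U, evalMat (g : GL (Fin p) k).val
      (G * constMat _ Y * G.adjugate - constMat _ Y) ∈ centralSeries U n := by
    intro g hg
    have h1 := conj_sub_mem_centralSeries hU n ⟨g, hg⟩ (by rw [hn]; trivial) hY
    simpa [G, constMat_self, evalMat_adjugate, hU.adjugate_eq hg] using h1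
  refine snd_evalMat_dualMat_mem hcomm hX (A := 0) ?_
  simp only [map_sub, map_mul, evalMat_adjugate, evalMat_constMat, G, evalMat_generic,
    constMat_dualNumber, hU.adjugate_dualMat hX]
  simp only [dualMat_mul, dualMat_sub]
  congr 1
  · simp
  · simp only [one_mul, mul_one, mul_zero, zero_add, mul_neg, sub_zero]
    abel

/-! ### Points over a `k`-algebra -/

section Points

variable {R : Type*} [CommRing R] [Algebra k R]

/-- A polynomial with coefficients in `R` that vanishes on `U` vanishes on `U(R)`. -/
theorem eval_eq_zero_of_points {U : Subgroup (GL (Fin p) k)}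
    (Φ : MvPolynomial (Fin p × Fin p) R)
    (hΦ : ∀ g ∈ U, MvPolynomial.eval (fun ij => constMat R (g : GL (Fin p) k).val ij.1 ij.2) Φ = 0)
    {M : Matrix (Fin p) (Fin p) R} (hM : ∀ f ∈ vanishingIdeal U, evalAt M f = 0) :
    MvPolynomial.eval (fun ij => M ij.1 ij.2) Φ = 0 := by
  classical
  -- In a `k`-basis of `R`, `Φ = ∑ b_i F_i` with `F_i` over `k`. On `U` the value of `F_i` is a
  -- coordinate of the value of `Φ`, hence zero.
  let b := Module.Basis.ofVectorSpace k R
  let F := fun i => ∑ s ∈ Φ.support, MvPolynomial.monomial s (b.repr (Φ.coeff s) i)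
  have hF : ∀ i, F i ∈ vanishingIdeal U := by
    intro i g hg
    have h := congrArg (fun r => b.repr r i) (hΦ g hg)
    simp only [MvPolynomial.eval_eq, constMat_apply, ← map_pow, ← map_prod, map_sum, map_zero,
      Finsupp.coe_zero, Pi.zero_apply, Finsupp.finsetSum_apply] at h
    rw [← h]
    simp only [F, evalAt_sum]
    refine Finset.sum_congr rfl fun s _ => ?_
    rw [mul_comm, ← Algebra.smul_def, map_smul, Finsupp.smul_apply, smul_eq_mul, mul_comm]
    simp [evalAt, MvPolynomial.aeval_monomial, Finsupp.prod]
  set T := Φ.support.biUnion fun s => (b.repr (Φ.coeff s)).support with hT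
  have hc : ∀ s ∈ Φ.support, Φ.coeff s = ∑ i ∈ T, b.repr (Φ.coeff s) i • b i := by
    intro s hs
    conv_lhs => rw [← b.linearCombination_repr (Φ.coeff s)]
    rw [Finsupp.linearCombination_apply]
    exact Finsupp.sum_of_support_subset _ (Finset.subset_biUnion_of_mem
      (fun s => (b.repr (Φ.coeff s)).support) hs) _ (by simp)
  have : MvPolynomial.eval (fun ij => M ij.1 ij.2) Φ = ∑ i ∈ T, b i * evalAt M (F i) := by
    simp only [F, evalAt_sum, Finset.mul_sum]
    rw [Finset.sum_comm, MvPolynomial.eval_eq]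
    refine Finset.sum_congr rfl fun s hs => ?_
    conv_lhs => rw [hc s hs, Finset.sum_mul]
    refine Finset.sum_congr rfl fun i _ => ?_
    simp only [evalAt, MvPolynomial.aeval_monomial, Finsupp.prod, Algebra.smul_def]
    ring
  rw [this]
  exact Finset.sum_eq_zero fun i _ => by rw [hM _ (hF i), mul_zero]

/-- Two density steps: for `g ∈ U` the polynomial `f(g·)` vanishes at `y`; hence `f(·y)`, with
coefficients in `R`, vanishes on `U` and so at `x`. -/
theorem mul_mem_points {U : Subgroup (GL (Fin p) k)} {x y : GL (Fin p) R} (hx : x ∈ points U R)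
    (hy : y ∈ points U R) : x * y ∈ points U R := by
  intro f hf
  let Φ : MvPolynomial (Fin p × Fin p) R := evalAt
    (mvPolynomialX (Fin p) (Fin p) R * y.val.map (MvPolynomial.C (σ := Fin p × Fin p))) f
  have hΦ : ∀ N : Matrix (Fin p) (Fin p) R,
      MvPolynomial.eval (fun ij => N ij.1 ij.2) Φ = evalAt (N * y.val) f := by
    intro N
    have h1 := evalAt_map ((MvPolynomial.aeval (fun ij : Fin p × Fin p => N ij.1 ij.2) :
      MvPolynomial (Fin p × Fin p) R →ₐ[R] R).restrictScalars k)
      (mvPolynomialX (Fin p) (Fin p) R * y.val.map (MvPolynomial.C (σ := Fin p × Fin p))) f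
    rw [← MvPolynomial.coe_aeval_eq_eval]
    refine h1.symm.trans ?_
    congr 1
    ext i j
    simp [mul_apply]
  have h := eval_eq_zero_of_points (U := U) Φ (fun g hg => ?_) hx
  · rwa [hΦ] at h
  rw [hΦ (constMat R g.val)]
  have hmem : substMat (constMat _ g.val * mvPolynomialX (Fin p) (Fin p) k) f ∈
      vanishingIdeal U := by
    intro h hh
    rw [evalAt_substMat]
    simpa [constMat_self] using hf (g * h) (U.mul_mem hg hh)
  have := hy _ hmem
  rwa [evalAt_substMat, map_mul, evalMat_constMat, evalMat_generic] at this

theorem one_mem_points (U : Subgroup (GL (Fin p) k)) : (1 : GL (Fin p) R) ∈ points U R := by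
  intro f hf
  have h1 : evalAt (1 : Matrix (Fin p) (Fin p) k) f = 0 := hf 1 U.one_mem
  have h2 := evalAt_map (Algebra.ofId k R) (1 : Matrix (Fin p) (Fin p) k) f
  rw [h1, map_zero] at h2
  rw [← h2]
  congr 1
  exact (map_one (constMat R)).symm

end Points

/-! ### Laurent series -/

section Laurent

theorem coeff_algebraMap_mul (c : k) (f : k⸨X⸩) (j : ℤ) :
    (f * algebraMap k k⸨X⸩ c).coeff j = f.coeff j * c := by
  have h : algebraMap k k⸨X⸩ c = HahnSeries.C c :=
    (HahnSeries.algebraMap_apply' ..).trans (HahnSeries.ofPowerSeries_C c)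
  rw [h, HahnSeries.C_apply, HahnSeries.coeff_mul_single_zero]

/-- An additive map between commutative `k`-algebras that commutes with multiplication by
constants, as a linear map for the module structures underlying the algebra structures. -/
def linearMapOfAlgebraMap {R S : Type*} [CommRing R] [Algebra k R] [CommRing S] [Algebra k S]
    (f : R →+ S) (hf : ∀ c r, f (r * algebraMap k R c) = f r * algebraMap k S c) : R →ₗ[k] S where
  toFun := f
  map_add' := map_add f
  map_smul' c r := by
    rw [Algebra.smul_def, mul_comm, hf, mul_comm, ← Algebra.smul_def, RingHom.id_apply]

/-- The `j`-th coefficient, as an additive map. -/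
def coeffHom (j : ℤ) : k⸨X⸩ →+ k where
  toFun f := f.coeff j
  map_zero' := rfl
  map_add' _ _ := rfl

theorem coeff_derivative (f : k⸨X⸩) (j : ℤ) :
    (LaurentSeries.derivative k f).coeff j = (j + 1 : ℤ) * f.coeff (j + 1) := by
  rw [LaurentSeries.derivative_apply, LaurentSeries.hasseDeriv_coeff, Nat.cast_one,
    Ring.choose_one_right, zsmul_eq_mul]

/-- The Euler derivation `t d/dt`. -/
def euler (f : k⸨X⸩) : k⸨X⸩ where
  coeff j := j * f.coeff j
  isPWO_support' := f.isPWO_support.mono fun j hj h => hj (by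
    change (j : k) * f.coeff j = 0
    rw [h, mul_zero])

theorem support_euler_subset (f : k⸨X⸩) : (euler f).support ⊆ f.support := fun j hj h => hj (by
  change (j : k) * f.coeff j = 0
  rw [h, mul_zero])

/-- Exponents add under multiplication, so Leibniz holds term by term with no shift of degree; this
is why `d/dt` is treated through `t d/dt`. -/
theorem euler_mul (f g : k⸨X⸩) : euler (f * g) = euler f * g + f * euler g := by
  ext j
  rw [HahnSeries.coeff_add,
    HahnSeries.coeff_mul_left' f.isPWO_support (support_euler_subset f),
    HahnSeries.coeff_mul_right' g.isPWO_support (support_euler_subset g), ← Finset.sum_add_distrib]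
  change (j : k) * (f * g).coeff j = _
  rw [HahnSeries.coeff_mul, Finset.mul_sum]
  refine Finset.sum_congr rfl fun ij hij => ?_
  rw [Finset.mem_antidiagonal] at hij
  change _ = (ij.1 : k) * f.coeff ij.1 * g.coeff ij.2 + f.coeff ij.1 * ((ij.2 : k) * g.coeff ij.2)
  rw [← hij.2.2]
  push_cast
  ring

theorem derivative_eq_single_mul_euler (f : k⸨X⸩) :
    LaurentSeries.derivative k f = HahnSeries.single (-1) 1 * euler f := by
  ext j
  rw [coeff_derivative, HahnSeries.coeff_single_mul, sub_neg_eq_add, one_mul]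
  rfl

theorem derivative_mul (f g : k⸨X⸩) :
    LaurentSeries.derivative k (f * g) =
      LaurentSeries.derivative k f * g + f * LaurentSeries.derivative k g := by
  simp only [derivative_eq_single_mul_euler, euler_mul]
  ring

/-- A product of series of orders at least `a` and `b` has order at least `a + b`. -/
theorem coeff_mul_eq_zero {f g : k⸨X⸩} {a b : ℤ} (hf : ∀ j < a, f.coeff j = 0)
    (hg : ∀ j < b, g.coeff j = 0) {j : ℤ} (hj : j < a + b) : (f * g).coeff j = 0 := by
  rw [HahnSeries.coeff_mul]
  refine Finset.sum_eq_zero fun ij hij => ?_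
  rw [Finset.mem_antidiagonal] at hij
  rcases lt_or_ge ij.1 a with h | h
  · rw [hf _ h, zero_mul]
  · rw [hg ij.2 (by linarith [hij.2.2]), mul_zero]

end Laurent

/-! ### Matrices of Laurent series -/

theorem coeffMat_add (A B : Matrix (Fin p) (Fin p) k⸨X⸩) (j : ℤ) :
    coeffMat (A + B) j = coeffMat A j + coeffMat B j := rfl

theorem coeffMat_sub (A B : Matrix (Fin p) (Fin p) k⸨X⸩) (j : ℤ) :
    coeffMat (A - B) j = coeffMat A j - coeffMat B j := rfl

theorem coeffMat_neg (A : Matrix (Fin p) (Fin p) k⸨X⸩) (j : ℤ) :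
    coeffMat (-A) j = -coeffMat A j := rfl

theorem coeffMat_zero (j : ℤ) : coeffMat (0 : Matrix (Fin p) (Fin p) k⸨X⸩) j = 0 := rfl

theorem coeffMat_sum {ι : Type*} (s : Finset ι) (A : ι → Matrix (Fin p) (Fin p) k⸨X⸩) (j : ℤ) :
    coeffMat (∑ i ∈ s, A i) j = ∑ i ∈ s, coeffMat (A i) j := by
  classical
  induction s using Finset.induction_on with
  | empty => rfl
  | insert a s ha ih => rw [Finset.sum_insert ha, Finset.sum_insert ha, coeffMat_add, ih]

theorem coeffMat_smul_constMat (c : k⸨X⸩) (X : Matrix (Fin p) (Fin p) k) (j : ℤ) :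
    coeffMat (c • constMat k⸨X⸩ X) j = c.coeff j • X := by
  ext a b
  exact coeff_algebraMap_mul (X a b) c j

theorem ext_coeffMat {A B : Matrix (Fin p) (Fin p) k⸨X⸩} (h : ∀ j, coeffMat A j = coeffMat B j) :
    A = B := by
  ext a b j
  exact congrFun (congrFun (h j) a) b

/-- Extension of scalars `V ⊗ k((t))` of a space of matrices. -/
def extendScalars (V : Submodule k (Matrix (Fin p) (Fin p) k)) :
    Submodule k⸨X⸩ (Matrix (Fin p) (Fin p) k⸨X⸩) :=
  Submodule.span k⸨X⸩ (constMat k⸨X⸩ '' (V : Set (Matrix (Fin p) (Fin p) k)))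

theorem constMat_mem_extendScalars {V : Submodule k (Matrix (Fin p) (Fin p) k)}
    {X : Matrix (Fin p) (Fin p) k} (hX : X ∈ V) : constMat k⸨X⸩ X ∈ extendScalars V :=
  Submodule.subset_span ⟨X, hX, rfl⟩

/-- Take the images of the matrix units under a linear projection onto `V`. The coefficients are the
entries of `A` themselves, so bounds on the order carry over. -/
theorem exists_projection (V : Submodule k (Matrix (Fin p) (Fin p) k)) :
    ∃ E : Fin p → Fin p → Matrix (Fin p) (Fin p) k, (∀ i j, E i j ∈ V) ∧
      ∀ A : Matrix (Fin p) (Fin p) k⸨X⸩, (∀ j, coeffMat A j ∈ V) →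
        A = ∑ a, ∑ b, A a b • constMat k⸨X⸩ (E a b) := by
  obtain ⟨π, hπ⟩ := V.subtype.exists_leftInverse_of_injective V.ker_subtype
  refine ⟨fun a b => π (single a b 1), fun a b => (π (single a b 1)).2, fun A hA => ?_⟩
  refine ext_coeffMat fun j => ?_
  simp only [coeffMat_sum, coeffMat_smul_constMat]
  have h := congrArg Subtype.val (LinearMap.congr_fun hπ ⟨_, hA j⟩)
  simp only [LinearMap.comp_apply, LinearMap.id_apply, Submodule.subtype_apply] at h
  conv_lhs => rw [← h, matrix_eq_sum_single (coeffMat A j)]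
  simp only [map_sum, Submodule.coe_sum]
  refine Finset.sum_congr rfl fun a _ => Finset.sum_congr rfl fun b _ => ?_
  rw [show single a b (coeffMat A j a b) = coeffMat A j a b • single a b (1 : k) by
    simp [smul_single], map_smul]
  rfl

/-- The span form allows induction from constant matrices; the coefficient form is the one that can
be integrated. -/
theorem mem_extendScalars_iff {V : Submodule k (Matrix (Fin p) (Fin p) k)}
    {A : Matrix (Fin p) (Fin p) k⸨X⸩} : A ∈ extendScalars V ↔ ∀ j, coeffMat A j ∈ V := by
  constructor
  · intro hA
    rw [extendScalars] at hA
    induction hA using Submodule.closure_induction with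
    | zero => intro j; exact V.zero_mem
    | add x y _ _ hx hy => intro j; exact V.add_mem (hx j) (hy j)
    | smul_mem c x hx =>
      obtain ⟨X, hX, rfl⟩ := hx
      intro j
      rw [coeffMat_smul_constMat]
      exact V.smul_mem _ hX
  · intro hA
    obtain ⟨E, hE, h⟩ := exists_projection V
    rw [h A hA]
    exact Submodule.sum_mem _ fun a _ => Submodule.sum_mem _ fun b _ =>
      Submodule.smul_mem _ _ (constMat_mem_extendScalars (hE a b))

theorem commutator_mem_extendScalars {V W Z : Submodule k (Matrix (Fin p) (Fin p) k)}
    (h : ∀ X ∈ V, ∀ Y ∈ W, X * Y - Y * X ∈ Z) {A B : Matrix (Fin p) (Fin p) k⸨X⸩}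
    (hA : A ∈ extendScalars V) (hB : B ∈ extendScalars W) :
    A * B - B * A ∈ extendScalars Z := by
  rw [extendScalars] at hA hB
  induction hA using Submodule.span_induction with
  | zero => simp
  | add x y _ _ hx hy =>
    rw [show (x + y) * B - B * (x + y) = (x * B - B * x) + (y * B - B * y) by noncomm_ring]
    exact Submodule.add_mem _ hx hy
  | smul c x _ hx =>
    rw [smul_mul_assoc, mul_smul_comm, ← smul_sub]
    exact Submodule.smul_mem _ _ hx
  | mem x hx =>
    obtain ⟨X, hX, rfl⟩ := hx
    induction hB using Submodule.span_induction with
    | zero => simp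
    | add x y _ _ hx hy =>
      rw [show constMat k⸨X⸩ X * (x + y) - (x + y) * constMat k⸨X⸩ X =
        (constMat k⸨X⸩ X * x - x * constMat k⸨X⸩ X) +
          (constMat k⸨X⸩ X * y - y * constMat k⸨X⸩ X) by noncomm_ring]
      exact Submodule.add_mem _ hx hy
    | smul c x _ hx =>
      rw [smul_mul_assoc, mul_smul_comm, ← smul_sub]
      exact Submodule.smul_mem _ _ hx
    | mem y hy =>
      obtain ⟨Y, hY, rfl⟩ := hy
      rw [← map_mul, ← map_mul, ← map_sub]
      exact constMat_mem_extendScalars (h X hX Y hY)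

/-- The matrix `A` is divisible by `t ^ e`. -/
def OrderGE (e : ℤ) (A : Matrix (Fin p) (Fin p) k⸨X⸩) : Prop :=
  ∀ j < e, coeffMat A j = 0

theorem OrderGE.mono {e e' : ℤ} {A : Matrix (Fin p) (Fin p) k⸨X⸩} (hA : OrderGE e A)
    (h : e' ≤ e) : OrderGE e' A := fun j hj => hA j (hj.trans_le h)

theorem OrderGE.add {e : ℤ} {A B : Matrix (Fin p) (Fin p) k⸨X⸩} (hA : OrderGE e A)
    (hB : OrderGE e B) : OrderGE e (A + B) := fun j hj => by
  rw [coeffMat_add, hA j hj, hB j hj, add_zero]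

theorem OrderGE.sub {e : ℤ} {A B : Matrix (Fin p) (Fin p) k⸨X⸩} (hA : OrderGE e A)
    (hB : OrderGE e B) : OrderGE e (A - B) := fun j hj => by
  rw [coeffMat_sub, hA j hj, hB j hj, sub_zero]

theorem OrderGE.mul {a b : ℤ} {A B : Matrix (Fin p) (Fin p) k⸨X⸩} (hA : OrderGE a A)
    (hB : OrderGE b B) : OrderGE (a + b) (A * B) := fun j hj => by
  ext x y
  have : ∀ z, (A x z * B z y).coeff j = 0 := fun z =>
    coeff_mul_eq_zero (fun i hi => congrFun (congrFun (hA i hi) x) z)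
      (fun i hi => congrFun (congrFun (hB i hi) z) y) hj
  change ((A * B) x y).coeff j = 0
  rw [mul_apply]
  change coeffHom j _ = 0
  rw [map_sum]
  exact Finset.sum_eq_zero fun z _ => this z

theorem congrMod_iff {e : ℤ} {A B : Matrix (Fin p) (Fin p) k⸨X⸩} :
    CongrMod e A B ↔ OrderGE e (A - B) :=
  forall₂_congr fun j _ => by rw [coeffMat_sub, sub_eq_zero]

theorem orderGE_toLaurent (x : GL (Fin p) k⟦X⟧) : OrderGE 0 (toLaurent x).val := fun j hj => by
  ext a b
  change (HahnSeries.ofPowerSeries ℤ k (x.val a b)).coeff j = 0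
  rw [PowerSeries.coeff_coe, if_pos hj]

theorem toLaurent_mul (x y : GL (Fin p) k⟦X⟧) : toLaurent (x * y) = toLaurent x * toLaurent y :=
  map_mul _ _ _

theorem toLaurent_inv (x : GL (Fin p) k⟦X⟧) : toLaurent x⁻¹ = (toLaurent x)⁻¹ :=
  map_inv _ _

/-- The entrywise derivative. -/
def deriv (A : Matrix (Fin p) (Fin p) k⸨X⸩) : Matrix (Fin p) (Fin p) k⸨X⸩ :=
  A.map (LaurentSeries.derivative k)

theorem coeffMat_deriv (A : Matrix (Fin p) (Fin p) k⸨X⸩) (j : ℤ) :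
    coeffMat (deriv A) j = ((j + 1 : ℤ) : k) • coeffMat A (j + 1) := by
  ext a b
  exact coeff_derivative (A a b) j

theorem deriv_mul (A B : Matrix (Fin p) (Fin p) k⸨X⸩) :
    deriv (A * B) = deriv A * B + A * deriv B := by
  ext1 a b
  simp only [deriv, map_apply, mul_apply, map_sum, derivative_mul, Matrix.add_apply,
    Finset.sum_add_distrib]

theorem deriv_constMat (X : Matrix (Fin p) (Fin p) k) : deriv (constMat k⸨X⸩ X) = 0 := by
  refine ext_coeffMat fun j => ?_
  have h := coeffMat_smul_constMat 1 X (j + 1)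
  rw [one_smul] at h
  rw [coeffMat_deriv, coeffMat_zero, h, HahnSeries.coeff_one]
  split_ifs with hj
  · rw [hj, Int.cast_zero, zero_smul]
  · rw [zero_smul, smul_zero]

/-! ### The linear differential equation `dy/dt = B y` -/

theorem coeffMat_toLaurent (x : GL (Fin p) k⟦X⟧) (n : ℕ) :
    coeffMat (toLaurent x).val n = x.val.map (PowerSeries.coeff n) := by
  ext a b
  exact LaurentSeries.coeff_coe_powerSeries (x.val a b) n

/-- The coefficients of the solution of `dy/dt = B y`, `y(0) = 1`. -/
def solutionCoeff (B : ℕ → Matrix (Fin p) (Fin p) k) : ℕ → Matrix (Fin p) (Fin p) k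
  | 0 => 1
  | n + 1 => ((n + 1 : ℕ) : k)⁻¹ • ∑ i : Fin (n + 1), B (n - i) * solutionCoeff B i

theorem smul_solutionCoeff_succ [CharZero k] (B : ℕ → Matrix (Fin p) (Fin p) k) (n : ℕ) :
    ((n + 1 : ℕ) : k) • solutionCoeff B (n + 1) =
      ∑ ij ∈ Finset.HasAntidiagonal.antidiagonal n, B ij.1 * solutionCoeff B ij.2 := by
  rw [solutionCoeff, smul_smul, mul_inv_cancel₀ (Nat.cast_ne_zero.2 n.succ_ne_zero), one_smul,
    ← Finset.Nat.sum_antidiagonal_swap, Finset.Nat.sum_antidiagonal_eq_sum_range_succ_mk,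
    Fin.sum_univ_eq_sum_range (fun i => B (n - i) * solutionCoeff B i)]
  rfl

/-- Comparing coefficients gives a recursion solvable in characteristic zero; constant term `1`
makes the determinant a unit. -/
theorem exists_deriv_eq_mul [CharZero k] {B : Matrix (Fin p) (Fin p) k⸨X⸩} (hB : OrderGE 0 B) :
    ∃ y : GL (Fin p) k⟦X⟧, deriv (toLaurent y).val = B * (toLaurent y).val ∧
      OrderGE 1 ((toLaurent y).val - 1) := by
  set b : ℕ → Matrix (Fin p) (Fin p) k := fun n => coeffMat B n
  let Y : Matrix (Fin p) (Fin p) k⟦X⟧ := fun i j => PowerSeries.mk fun n => solutionCoeff b n i j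
  let B' : Matrix (Fin p) (Fin p) k⟦X⟧ := fun i j => PowerSeries.mk fun n => b n i j
  have hYc : ∀ n, Y.map (PowerSeries.coeff (R := k) n) = solutionCoeff b n := fun n => by
    ext i j
    exact PowerSeries.coeff_mk (R := k) n fun n => solutionCoeff b n i j
  have hY0 : Y.map (PowerSeries.constantCoeff (R := k)) = 1 := by
    rw [← PowerSeries.coeff_zero_eq_constantCoeff (R := k), hYc, solutionCoeff]
  have hunit : IsUnit Y.det := by
    rw [PowerSeries.isUnit_iff_constantCoeff, RingHom.map_det, RingHom.mapMatrix_apply, hY0,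
      det_one]
    exact isUnit_one
  let y : GL (Fin p) k⟦X⟧ := GeneralLinearGroup.mk'' Y hunit
  have hy : y.val = Y := rfl
  have hBB : B = B'.map (HahnSeries.ofPowerSeries ℤ k) := by
    refine ext_coeffMat fun j => ?_
    ext i l
    change _ = (HahnSeries.ofPowerSeries ℤ k (B' i l)).coeff j
    rw [PowerSeries.coeff_coe]
    split_ifs with hj
    · rw [hB j hj]; rfl
    · rw [PowerSeries.coeff_mk]
      simp only [b]
      rw [Int.natAbs_of_nonneg (not_lt.1 hj)]
  have hprod : B * (toLaurent y).val = (B' * Y).map (HahnSeries.ofPowerSeries ℤ k) := by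
    rw [hBB, Matrix.map_mul]
    rfl
  refine ⟨y, ?_, ?_⟩
  · refine ext_coeffMat fun j => ?_
    rw [coeffMat_deriv, hprod]
    ext i l
    change _ = (HahnSeries.ofPowerSeries ℤ k ((B' * Y) i l)).coeff j
    rw [PowerSeries.coeff_coe]
    split_ifs with hj
    -- In degree `-1` the factor `j + 1` vanishes; below that the coefficient of `y` does.
    · rcases (Int.add_one_le_of_lt hj).eq_or_lt with h | h
      · rw [h, Int.cast_zero, zero_smul]; rfl
      · rw [orderGE_toLaurent y _ h, smul_zero]; rfl
    · obtain ⟨n, rfl⟩ := Int.eq_ofNat_of_zero_le (not_lt.1 hj)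
      have h1 := congrFun (congrFun (smul_solutionCoeff_succ b n) i) l
      have h2 : coeffMat (toLaurent y).val ((n : ℤ) + 1) = solutionCoeff b (n + 1) := by
        have := coeffMat_toLaurent y (n + 1)
        rw [Nat.cast_add, Nat.cast_one] at this
        rw [this, hy, hYc]
      rw [h2, Int.natAbs_natCast, show (((n : ℤ) + 1 : ℤ) : k) = ((n + 1 : ℕ) : k) by push_cast; rfl,
        h1, mul_apply, map_sum]
      simp only [PowerSeries.coeff_mul, B', Y, PowerSeries.coeff_mk, Matrix.sum_apply, mul_apply]
      rw [Finset.sum_comm]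
  · intro j hj
    rcases lt_or_ge j 0 with h | h
    · ext i l
      have h1 := congrFun (congrFun (orderGE_toLaurent y j h) i) l
      have h2 := congrFun (congrFun (orderGE_toLaurent (1 : GL (Fin p) k⟦X⟧) j h) i) l
      rw [show toLaurent (1 : GL (Fin p) k⟦X⟧) = 1 from map_one _] at h2
      rw [coeffMat_sub, Matrix.sub_apply, h1]
      exact (congrArg _ h2).trans (sub_zero _)
    · obtain rfl : j = ((0 : ℕ) : ℤ) := by push_cast; lia
      have h2 := coeffMat_toLaurent (1 : GL (Fin p) k⟦X⟧) 0
      rw [show toLaurent (1 : GL (Fin p) k⟦X⟧) = 1 from map_one _, Units.val_one] at h2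
      rw [coeffMat_sub, coeffMat_toLaurent, h2, hy, hYc, solutionCoeff, sub_eq_zero,
        Units.val_one, Matrix.map_one _ (map_zero _) (PowerSeries.coeff_zero_one)]

theorem deriv_sub_one (M : Matrix (Fin p) (Fin p) k⸨X⸩) : deriv (M - 1) = deriv M := by
  have h := deriv_constMat (1 : Matrix (Fin p) (Fin p) k)
  rw [map_one] at h
  have h2 : deriv (M - 1) = deriv M - deriv 1 := Matrix.map_sub _ (fun a b => map_sub _ a b) _ _
  rw [h2, h, sub_zero]

/-- Integrating `BM` gains one order. The constant term is invisible to the derivative and is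
covered by `h1`. -/
theorem orderGE_sub_one_of_deriv [CharZero k] {M B : Matrix (Fin p) (Fin p) k⸨X⸩} {e : ℤ}
    (hB : OrderGE e B) (hM : OrderGE 0 M) (hd : deriv M = B * M) (h1 : OrderGE 1 (M - 1)) :
    OrderGE (e + 1) (M - 1) := by
  intro j hj
  rcases lt_or_ge j 1 with h | h
  · exact h1 j h
  · have h2 : coeffMat (deriv M) (j - 1) = 0 := by
      rw [hd]
      exact (hB.mul hM) _ (by linarith)
    rw [← deriv_sub_one, coeffMat_deriv, sub_add_cancel] at h2
    exact (smul_eq_zero.1 h2).resolve_left (Int.cast_ne_zero.2 (by lia))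

/-- The derivation `d/dt`, as a linear map. -/
def derivativeLin (k : Type*) [Field k] := linearMapOfAlgebraMap (k := k)
  (LaurentSeries.derivative k (V := k)).toAddMonoidHom (fun c r => by
    refine HahnSeries.ext (funext fun j => ?_)
    simp only [LinearMap.toAddMonoidHom_coe, coeff_derivative, coeff_algebraMap_mul, mul_assoc])

theorem derivative_evalAt (M : Matrix (Fin p) (Fin p) k⸨X⸩)
    (f : MvPolynomial (Fin p × Fin p) k) :
    LaurentSeries.derivative k (evalAt M f) =
      ∑ i, ∑ j, evalAt M (MvPolynomial.pderiv (i, j) f) * deriv M i j :=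
  derivation_evalAt (AlgHom.id k k⸨X⸩) (derivativeLin k) (fun a b => derivative_mul a b) M f

theorem derivative_evalAt_of_deriv {ι : Type*} (s : Finset ι) {M : Matrix (Fin p) (Fin p) k⸨X⸩}
    (c : ι → k⸨X⸩) (E : ι → Matrix (Fin p) (Fin p) k)
    (hd : deriv M = (∑ a ∈ s, c a • constMat k⸨X⸩ (E a)) * M)
    (f : MvPolynomial (Fin p × Fin p) k) :
    LaurentSeries.derivative k (evalAt M f) = ∑ a ∈ s, c a *
      evalAt M (∑ i, ∑ j, MvPolynomial.pderiv (i, j) f *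
        (constMat (MvPolynomial (Fin p × Fin p) k) (E a) *
          mvPolynomialX (Fin p) (Fin p) k) i j) := by
  have h2 : ∀ a i j, evalAt M ((constMat (MvPolynomial (Fin p × Fin p) k) (E a) *
      mvPolynomialX (Fin p) (Fin p) k) i j) = (constMat k⸨X⸩ (E a) * M) i j := by
    intro a i j
    rw [← evalMat_apply, map_mul, evalMat_constMat, evalMat_generic]
  rw [derivative_evalAt, hd]
  simp only [evalAt_sum, evalAt_mul, h2, Finset.sum_mul, Matrix.sum_apply, smul_mul_assoc,
    Matrix.smul_apply, smul_eq_mul, Finset.mul_sum]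
  conv_rhs => rw [Finset.sum_comm]
  refine Finset.sum_congr rfl fun i _ => ?_
  conv_rhs => rw [Finset.sum_comm]
  refine Finset.sum_congr rfl fun j _ => Finset.sum_congr rfl fun a _ => ?_
  exact mul_left_comm _ _ _

theorem map_constantCoeff_of_orderGE {y : GL (Fin p) k⟦X⟧}
    (h1 : OrderGE 1 ((toLaurent y).val - 1)) :
    y.val.map (PowerSeries.constantCoeff (R := k)) = 1 := by
  have h2 := coeffMat_toLaurent (1 : GL (Fin p) k⟦X⟧) 0
  rw [show toLaurent (1 : GL (Fin p) k⟦X⟧) = 1 from map_one _, Units.val_one] at h2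
  have h3 := h1 ((0 : ℕ) : ℤ) (by simp)
  rw [coeffMat_sub, coeffMat_toLaurent, h2, sub_eq_zero, Units.val_one,
    Matrix.map_one _ (map_zero _) (PowerSeries.coeff_zero_one)] at h3
  rw [← PowerSeries.coeff_zero_eq_constantCoeff, h3]

/-- The inclusion `k[[t]] → k((t))`. -/
def powerSeriesToLaurent (k : Type*) [Field k] : k⟦X⟧ →ₐ[k] k⸨X⸩ :=
  { HahnSeries.ofPowerSeries ℤ k with
    commutes' := fun _ => (HahnSeries.algebraMap_apply' ..).symm }

theorem evalAt_toLaurent (y : GL (Fin p) k⟦X⟧) (f : MvPolynomial (Fin p × Fin p) k) :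
    evalAt (toLaurent y).val f = HahnSeries.ofPowerSeries ℤ k (evalAt y.val f) :=
  evalAt_map (powerSeriesToLaurent k) y.val f

/-- The constant coefficient, as an algebra homomorphism. -/
def constantCoeffAlg (k : Type*) [Field k] : k⟦X⟧ →ₐ[k] k :=
  { PowerSeries.constantCoeff (R := k) with commutes' := fun r => PowerSeries.constantCoeff_C r }

theorem constantCoeff_evalAt {M : Matrix (Fin p) (Fin p) k⟦X⟧}
    (hM : M.map (PowerSeries.constantCoeff (R := k)) = 1) (f : MvPolynomial (Fin p × Fin p) k) :
    PowerSeries.constantCoeff (evalAt M f) = evalAt (1 : Matrix (Fin p) (Fin p) k) f := by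
  have := (evalAt_map (constantCoeffAlg k) M f).symm
  rw [← hM]
  exact this

/-- The solution of `dy/dt = B y`, `y(0) = 1`, with `B ∈ 𝔲 ⊗ k[[t]]`, lies in `U(k[[t]])`. -/
theorem mem_points_of_deriv [CharZero k] {U : Subgroup (GL (Fin p) k)} {y : GL (Fin p) k⟦X⟧}
    {B : Matrix (Fin p) (Fin p) k⸨X⸩} (hB : OrderGE 0 B) (hBU : IsConnection U B)
    (hd : deriv (toLaurent y).val = B * (toLaurent y).val)
    (h1 : OrderGE 1 ((toLaurent y).val - 1)) : y ∈ points U k⟦X⟧ := by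
  obtain ⟨E, hE, hBE⟩ := exists_projection (lieAlg U)
  have hsum : B = ∑ ab : Fin p × Fin p, B ab.1 ab.2 • constMat k⸨X⸩ (E ab.1 ab.2) :=
    (hBE B hBU).trans (Fintype.sum_prod_type
      (fun ab : Fin p × Fin p => B ab.1 ab.2 • constMat k⸨X⸩ (E ab.1 ab.2))).symm
  have hderiv := derivative_evalAt_of_deriv Finset.univ (fun ab : Fin p × Fin p => B ab.1 ab.2)
    (fun ab => E ab.1 ab.2) (hd.trans (congrArg (· * (toLaurent y).val) hsum))
  -- The induction treats all `f` in the ideal at once: `d/dt f(y)` is a combination, with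
  -- coefficients regular in `t`, of values at `y` of other members of the ideal. The initial value
  -- is `f(1) = 0`.
  have key : ∀ n : ℕ, ∀ f ∈ vanishingIdeal U, ∀ j < (n : ℤ),
      (evalAt (toLaurent y).val f).coeff j = 0 := by
    intro n
    induction n with
    | zero =>
      intro f _ j hj
      rw [evalAt_toLaurent, PowerSeries.coeff_coe, if_pos (by simpa using hj)]
    | succ n ih =>
      intro f hf j hj
      rcases lt_or_ge j n with h | h
      · exact ih f hf j h
      obtain rfl : j = n := by push_cast at hj; lia
      rcases n.eq_zero_or_pos with rfl | hn
      · rw [evalAt_toLaurent, LaurentSeries.coeff_coe_powerSeries,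
          PowerSeries.coeff_zero_eq_constantCoeff,
          constantCoeff_evalAt (map_constantCoeff_of_orderGE h1)]
        exact hf 1 U.one_mem
      · have h2 := coeff_derivative (evalAt (toLaurent y).val f) (n - 1)
        rw [sub_add_cancel, hderiv] at h2
        have h3 : ((n : ℤ) : k) * (evalAt (toLaurent y).val f).coeff n = 0 := by
          rw [← h2]
          rw [HahnSeries.coeff_sum]
          refine Finset.sum_eq_zero fun ab _ => ?_
          exact coeff_mul_eq_zero (fun i hi => congrFun (congrFun (hB i hi) ab.1) ab.2)
            (ih _ (pderiv_mem_vanishingIdeal (hE ab.1 ab.2) hf)) (by lia)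
        exact (mul_eq_zero.1 h3).resolve_left (Int.cast_ne_zero.2 (by lia))
  intro f hf
  ext n
  rw [← LaurentSeries.coeff_coe_powerSeries, ← evalAt_toLaurent, key (n + 1) f hf n (by simp)]
  simp

/-! ### The adjoint action of points of `U` on `𝔲 ⊗ k((t))` -/

theorem isConnection_iff {U : Subgroup (GL (Fin p) k)} {A : Matrix (Fin p) (Fin p) k⸨X⸩} :
    IsConnection U A ↔ A ∈ extendScalars (lieAlg U) := mem_extendScalars_iff.symm

theorem toLaurent_mem_points {U : Subgroup (GL (Fin p) k)} {x : GL (Fin p) k⟦X⟧}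
    (hx : x ∈ points U k⟦X⟧) : toLaurent x ∈ points U k⸨X⸩ := fun f hf => by
  rw [evalAt_toLaurent, hx f hf, map_zero]

theorem conj_mem_extendScalars_lieAlg {U : Subgroup (GL (Fin p) k)} (hU : IsUnipotentGroup U)
    {x : GL (Fin p) k⸨X⸩} (hx : x ∈ points U k⸨X⸩) {A : Matrix (Fin p) (Fin p) k⸨X⸩}
    (hA : A ∈ extendScalars (lieAlg U)) :
    x.val * A * (x⁻¹).val ∈ extendScalars (lieAlg U) := by
  rw [extendScalars] at hA
  induction hA using Submodule.span_induction with
  | zero => simp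
  | add a b _ _ ha hb =>
    rw [mul_add, add_mul]
    exact Submodule.add_mem _ ha hb
  | smul c a _ ha =>
    rw [mul_smul_comm, smul_mul_assoc]
    exact Submodule.smul_mem _ _ ha
  | mem a ha =>
    obtain ⟨X, hX, rfl⟩ := ha
    rw [mem_extendScalars_iff]
    intro j
    have hQ : ∀ g ∈ U, evalMat (g : GL (Fin p) k).val (mvPolynomialX (Fin p) (Fin p) k *
        constMat _ X * (mvPolynomialX (Fin p) (Fin p) k).adjugate) ∈ lieAlg U := by
      intro g hg
      rw [map_mul, map_mul, evalMat_adjugate, evalMat_generic, evalMat_constMat, constMat_self,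
        hU.adjugate_eq hg]
      exact conj_mem_lieAlg hg hX
    have h := map_evalMat_mem hQ hx (linearMapOfAlgebraMap (coeffHom j)
      (fun c r => coeff_algebraMap_mul c r j))
    rw [map_mul, map_mul, evalMat_adjugate, evalMat_generic, evalMat_constMat,
      adjugate_eq_of_mul_eq_one (hU.det_eq_one_of_points hx) (N := (x⁻¹).val)
        (by rw [← Units.val_mul, mul_inv_cancel, Units.val_one])] at h
    exact h

theorem orderGE_toLaurent_inv (x : GL (Fin p) k⟦X⟧) : OrderGE 0 ((toLaurent x)⁻¹).val := by
  rw [← toLaurent_inv]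
  exact orderGE_toLaurent _

theorem conj_sub_eq {R : Type*} [Ring R] (x : Rˣ) (a : R) :
    x.val * a * (x⁻¹).val - a = ((x.val - 1) * a - a * (x.val - 1)) * (x⁻¹).val := by
  have h : (x.val - 1) * a - a * (x.val - 1) = x.val * a - a * x.val := by noncomm_ring
  rw [h, sub_mul, mul_assoc a, Units.mul_inv, mul_one]

theorem OrderGE.conj_sub {x : GL (Fin p) k⟦X⟧} {e r : ℤ} (hx : OrderGE e ((toLaurent x).val - 1))
    {A : Matrix (Fin p) (Fin p) k⸨X⸩} (hA : OrderGE r A) :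
    OrderGE (e + r) ((toLaurent x).val * A * ((toLaurent x)⁻¹).val - A) := by
  rw [conj_sub_eq]
  have h2 := hA.mul hx
  rw [add_comm] at h2
  have h3 := ((hx.mul hA).sub h2).mul (orderGE_toLaurent_inv x)
  rwa [add_zero] at h3

theorem orderGE_constMat (X : Matrix (Fin p) (Fin p) k) : OrderGE 0 (constMat k⸨X⸩ X) := by
  intro j hj
  have h := coeffMat_smul_constMat 1 X j
  rw [one_smul, HahnSeries.coeff_one, if_neg hj.ne, zero_smul] at h
  exact h

/-- If `y ∈ U(k[[t]])` is congruent to `1` modulo `t` and its logarithmic derivative lies in the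
`(i+1)`-st term of the central series, then `Ad(y) - 1` maps `𝔲 ⊗ k((t))` to the `i`-th term. -/
theorem conj_sub_mem_extendScalars [CharZero k] {U : Subgroup (GL (Fin p) k)}
    (hU : IsUnipotentGroup U) {y : GL (Fin p) k⟦X⟧} (hy : y ∈ points U k⟦X⟧) {i : ℕ}
    {E : Matrix (Fin p) (Fin p) k⸨X⸩} (hE : E ∈ extendScalars (centralSeries U (i + 1)))
    (hd : deriv (toLaurent y).val = E * (toLaurent y).val)
    (h1 : OrderGE 1 ((toLaurent y).val - 1))
    {A : Matrix (Fin p) (Fin p) k⸨X⸩} (hA : A ∈ extendScalars (lieAlg U)) :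
    (toLaurent y).val * A * ((toLaurent y)⁻¹).val - A ∈ extendScalars (centralSeries U i) := by
  have hy' := toLaurent_mem_points hy
  set x := toLaurent y with hx
  rw [extendScalars] at hA
  induction hA using Submodule.span_induction with
  | zero => simp
  | add a b _ _ ha hb =>
    rw [mul_add, add_mul, add_sub_add_comm]
    exact Submodule.add_mem _ ha hb
  | smul c a _ ha =>
    rw [mul_smul_comm, smul_mul_assoc, ← smul_sub]
    exact Submodule.smul_mem _ _ ha
  | mem a ha =>
    obtain ⟨X, hX, rfl⟩ := ha
    set N := x.val * constMat k⸨X⸩ X * (x⁻¹).val with hN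
    have hNU : N ∈ extendScalars (lieAlg U) :=
      conj_mem_extendScalars_lieAlg hU hy' (constMat_mem_extendScalars hX)
    have hNx : N * x.val = x.val * constMat k⸨X⸩ X := by
      rw [hN, mul_assoc, Units.inv_mul, mul_one]
    have hdN : deriv N = E * N - N * E := by
      have h2 := congrArg deriv hNx
      rw [deriv_mul N, deriv_mul x.val (constMat k⸨X⸩ X), deriv_constMat, mul_zero, add_zero, hd,
        mul_assoc E, ← hNx] at h2
      rw [← sub_eq_zero, ← Units.mul_left_eq_zero x]
      rw [← sub_eq_zero] at h2
      rw [← h2]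
      noncomm_ring
    have hcomm : deriv (N - constMat k⸨X⸩ X) ∈ extendScalars (centralSeries U i) := by
      have h2 : deriv (N - constMat k⸨X⸩ X) = deriv N - deriv (constMat k⸨X⸩ X) :=
        Matrix.map_sub _ (fun a b => map_sub _ a b) _ _
      rw [h2, deriv_constMat, sub_zero, hdN]
      exact commutator_mem_extendScalars (fun W hW => mem_centralSeries_succ.1 hW) hE hNU
    rw [mem_extendScalars_iff] at hcomm ⊢
    intro j
    -- Up to degree `0` the difference vanishes since `y ≡ 1` modulo `t`; in degree `j ≥ 1` divide
    -- the coefficient of the derivative by `j`.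
    rcases lt_or_ge j 1 with hj | hj
    · rw [(h1.conj_sub (orderGE_constMat X)) j (by simpa using hj)]
      exact Submodule.zero_mem _
    · have h3 := hcomm (j - 1)
      rw [coeffMat_deriv, sub_add_cancel] at h3
      exact (Submodule.smul_mem_iff _ (Int.cast_ne_zero.2 (by lia))).1 h3

/-! ### Gauge equivalence -/

/-- The inverse-free form of the gauge equation composes directly under products. -/
theorem gauge_eq_of_deriv {x : GL (Fin p) k⸨X⸩} {A B : Matrix (Fin p) (Fin p) k⸨X⸩}
    (h : deriv x.val + x.val * A = B * x.val) : gauge x A = B := by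
  change x.val * A * (x⁻¹).val + deriv x.val * (x⁻¹).val = B
  rw [← add_mul, add_comm, h, mul_assoc, Units.mul_inv, mul_one]

/-- One step of the approximation: if `B - A` lies in the `(i+1)`-st term of the central series,
then a gauge transformation moves `A` to a connection `C` such that `B - C` lies in the `i`-th
term. -/
theorem exists_gauge_step [CharZero k] {U : Subgroup (GL (Fin p) k)} (hU : IsUnipotentGroup U)
    {i : ℕ} {A B : Matrix (Fin p) (Fin p) k⸨X⸩} (hA : IsConnection U A) (hB : IsConnection U B)
    {r e : ℤ} (he : 0 ≤ e) (hAr : OrderGE (-r) A) (hAB : OrderGE e (B - A))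
    (hi : B - A ∈ extendScalars (centralSeries U (i + 1))) :
    ∃ y ∈ points U k⟦X⟧, ∃ C, IsConnection U C ∧
      deriv (toLaurent y).val + (toLaurent y).val * A = C * (toLaurent y).val ∧
      OrderGE (e + 1) ((toLaurent y).val - 1) ∧ OrderGE (e + 1 - r) (B - C) ∧
      B - C ∈ extendScalars (centralSeries U i) := by
  -- With logarithmic derivative `B - A`, gauging by `y` gives `y A y⁻¹ + B - A = B + D`.
  obtain ⟨y, hd, h1⟩ := exists_deriv_eq_mul (hAB.mono he)
  have hABU : IsConnection U (B - A) := fun j => Submodule.sub_mem _ (hB j) (hA j)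
  have hy := mem_points_of_deriv (hAB.mono he) hABU hd h1
  have hye := orderGE_sub_one_of_deriv hAB (orderGE_toLaurent y) hd h1
  set D := (toLaurent y).val * A * ((toLaurent y)⁻¹).val - A with hD
  have hBC : B - (B + D) = -D := by abel
  have hneg : ∀ {e : ℤ} {M : Matrix (Fin p) (Fin p) k⸨X⸩}, OrderGE e M → OrderGE e (-M) :=
    fun h j hj => by rw [coeffMat_neg, h j hj, neg_zero]
  have hADU := conj_mem_extendScalars_lieAlg hU (toLaurent_mem_points hy) (isConnection_iff.1 hA)
  refine ⟨y, hy, B + D, ?_, ?_, hye, ?_, ?_⟩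
  · rw [isConnection_iff] at hA hB ⊢
    exact Submodule.add_mem _ hB (Submodule.sub_mem _ hADU hA)
  · have h2 : D * (toLaurent y).val = (toLaurent y).val * A - A * (toLaurent y).val := by
      rw [hD, sub_mul, mul_assoc _ _ (toLaurent y).val, Units.inv_mul, mul_one]
    rw [hd, add_mul, h2]
    noncomm_ring
  · rw [hBC]
    exact hneg (hye.conj_sub hAr)
  · rw [hBC]
    exact Submodule.neg_mem _ (conj_sub_mem_extendScalars hU hy hi hd h1 (isConnection_iff.1 hA))

/-- The quantity `e - (i - 1)(r - 1)` is unchanged by a step, which replaces `(i + 1, e)` by `(i, e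
+ 1 - r)`. The shift `i - 1` reflects that the last step may leave `e` negative, the error then
being zero. -/
theorem exists_gauge_of_mem_centralSeries [CharZero k] {U : Subgroup (GL (Fin p) k)}
    (hU : IsUnipotentGroup U) {B : Matrix (Fin p) (Fin p) k⸨X⸩} (hB : IsConnection U B)
    {r : ℤ} (hr : 1 ≤ r) (i : ℕ) {A : Matrix (Fin p) (Fin p) k⸨X⸩} (hA : IsConnection U A)
    {e : ℤ} (he : 0 ≤ e - ((i : ℤ) - 1) * (r - 1)) (hAr : OrderGE (-r) A)
    (hAB : OrderGE e (B - A)) (hi : B - A ∈ extendScalars (centralSeries U i)) :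
    ∃ x ∈ points U k⟦X⟧,
      OrderGE (e - ((i : ℤ) - 1) * (r - 1) + 1) ((toLaurent x).val - 1) ∧
      deriv (toLaurent x).val + (toLaurent x).val * A = B * (toLaurent x).val := by
  induction i generalizing A e with
  | zero =>
    have hBA : B = A := by
      refine ext_coeffMat fun j => ?_
      have h := mem_extendScalars_iff.1 hi j
      exact sub_eq_zero.1 (by simpa [centralSeries, coeffMat_sub] using h)
    have h1 : (toLaurent (1 : GL (Fin p) k⟦X⟧)).val = 1 := by
      rw [show toLaurent (1 : GL (Fin p) k⟦X⟧) = 1 from map_one _, Units.val_one]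
    refine ⟨1, one_mem_points U, ?_, ?_⟩
    · rw [h1, sub_self]
      exact fun j _ => rfl
    · rw [h1, ← map_one (constMat (k := k) k⸨X⸩), deriv_constMat, map_one, hBA, one_mul, mul_one,
        zero_add]
  | succ i ih =>
    push_cast at he ⊢
    have hmono : e - ((i : ℤ) + 1 - 1) * (r - 1) ≤ e := by nlinarith
    obtain ⟨y, hy, C, hC, hyC, hy1, hBC, hBCi⟩ :=
      exists_gauge_step hU hA hB (he.trans hmono) hAr hAB hi
    have hexp : e + 1 - r - ((i : ℤ) - 1) * (r - 1) = e - ((i : ℤ) + 1 - 1) * (r - 1) := by ring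
    -- The pole does not worsen, since `e + 1 - r ≥ -r`; so `r` stays fixed in the iteration.
    have hCr : OrderGE (-r) C := by
      have h := (hAr.add (hAB.mono (by linarith))).sub (hBC.mono (by linarith))
      rwa [show A + (B - A) - (B - C) = C by abel] at h
    obtain ⟨x, hx, hx1, hxB⟩ := ih hC (by rw [hexp]; exact he) hCr hBC hBCi
    refine ⟨x * y, mul_mem_points hx hy, ?_, ?_⟩
    · rw [hexp] at hx1
      rw [toLaurent_mul, Units.val_mul, show (toLaurent x).val * (toLaurent y).val - 1 =
        ((toLaurent x).val - 1) * (toLaurent y).val + ((toLaurent y).val - 1) by noncomm_ring]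
      have h := hx1.mul (orderGE_toLaurent y)
      rw [add_zero] at h
      exact h.add (hy1.mono (by linarith))
    · rw [toLaurent_mul, Units.val_mul, deriv_mul, add_assoc, mul_assoc, ← mul_add, hyC,
        ← mul_assoc, ← mul_assoc, ← add_mul, hxB]

theorem exists_gauge_eq [CharZero k] {U : Subgroup (GL (Fin p) k)} (hU : IsUnipotentGroup U)
    {n : ℕ} (hn : Subgroup.upperCentralSeries U (n + 1) = ⊤)
    {A B : Matrix (Fin p) (Fin p) k⸨X⸩} (hA : IsConnection U A) (hB : IsConnection U B)
    {r e : ℤ} (hr : 1 ≤ r) (hAr : OrderGE (-r) A) (he : n * (r - 1) ≤ e) (hAB : CongrMod e B A) :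
    ∃ x ∈ points U k⟦X⟧, CongrMod (e - n * (r - 1) + 1) (toLaurent x).val 1 ∧
      gauge (toLaurent x) A = B := by
  have hi : B - A ∈ extendScalars (centralSeries U (n + 1)) := by
    rw [mem_extendScalars_iff]
    exact fun j => lieAlg_le_centralSeries hU hn (Submodule.sub_mem _ (hB j) (hA j))
  obtain ⟨x, hx, hx1, hxB⟩ := exists_gauge_of_mem_centralSeries hU hB hr (n + 1) hA
    (by push_cast; linarith) hAr (congrMod_iff.1 hAB) hi
  refine ⟨x, hx, congrMod_iff.2 ?_, gauge_eq_of_deriv hxB⟩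
  push_cast at hx1
  rwa [add_sub_cancel_right] at hx1

end FormalConnection

end

theorem mainTheorem10 {k : Type*} [Field k] [IsAlgClosed k] [CharZero k] (p : ℕ)
    (U : Subgroup (GL (Fin p) k)) (hU : FormalConnection.IsUnipotentGroup U)
    (n : ℕ) (hn : FormalConnection.HasNilClass U n)
    (A : Matrix (Fin p) (Fin p) (LaurentSeries k)) (hA : FormalConnection.IsConnection U A)
    (m : ℤ) (hm : FormalConnection.HasOrder A m) :
    (-1 < m →
      ∃ x ∈ FormalConnection.points U (PowerSeries k),
        FormalConnection.CongrMod (m + 1) (FormalConnection.toLaurent x).val 1 ∧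
        FormalConnection.gauge (FormalConnection.toLaurent x) A = 0) ∧
    (m ≤ -1 →
      (∀ B : Matrix (Fin p) (Fin p) (LaurentSeries k), FormalConnection.IsConnection U B →
        (∀ j : ℤ, j < n * (|m| - 1) →
          FormalConnection.coeffMat B j = FormalConnection.coeffMat A j) →
        ∃ x ∈ FormalConnection.points U (LaurentSeries k), FormalConnection.gauge x A = B) ∧
      (∀ B : Matrix (Fin p) (Fin p) (LaurentSeries k), FormalConnection.IsConnection U B →
        ∀ l : ℤ, n * (|m| - 1) ≤ l → FormalConnection.CongrMod l B A →
        ∃ x ∈ FormalConnection.points U (PowerSeries k),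
          FormalConnection.CongrMod (l - n * |m| + n + 1)
            (FormalConnection.toLaurent x).val 1 ∧
          FormalConnection.gauge (FormalConnection.toLaurent x) A = B)) := by
  have hcentral : Subgroup.upperCentralSeries U (n + 1) = ⊤ := hn.1
  refine ⟨fun hm' => ?_, fun hm' => ?_⟩
  · have h0 : FormalConnection.IsConnection U (0 : Matrix (Fin p) (Fin p) (LaurentSeries k)) :=
      fun _ => Submodule.zero_mem _
    -- With `r = 1` no order is lost, and `A ≡ 0` modulo `t^m` is the required congruence with
    -- target `0`.
    obtain ⟨x, hx, hx1, hxA⟩ := FormalConnection.exists_gauge_eq hU hcentral hA h0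
      (r := 1) (e := m) le_rfl (fun j hj => hm.1 j (by lia)) (by simp; lia)
      (fun j hj => (hm.1 j hj).symm)
    exact ⟨x, hx, by simpa using hx1, hxA⟩
  · have hr : 1 ≤ |m| := by rw [abs_of_neg (by lia)]; lia
    have hAr : FormalConnection.OrderGE (-|m|) A := by
      rw [abs_of_neg (by lia), neg_neg]
      exact hm.1
    refine ⟨fun B hB hAB => ?_, fun B hB l hl hAB => ?_⟩
    · obtain ⟨x, hx, -, hxB⟩ := FormalConnection.exists_gauge_eq hU hcentral hA hB hr hAr le_rfl hAB
      exact ⟨_, FormalConnection.toLaurent_mem_points hx, hxB⟩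
    · obtain ⟨x, hx, hx1, hxB⟩ := FormalConnection.exists_gauge_eq hU hcentral hA hB hr hAr hl hAB
      refine ⟨x, hx, ?_, hxB⟩
      rwa [show l - n * |m| + n + 1 = l - n * (|m| - 1) + 1 by ring]
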